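/- Let $\mathfrak g$ be a finite-dimensional complex Lie algebra which is sympathetic, that is, $Z(\mathfrak g)=0$, $[\mathfrak g,\mathfrak g]=\mathfrak g$ and every derivation of $\mathfrak g$ is inner. Suppose that $\mathfrak g$ has a Levi decomposition $\mathfrak g=\mathfrak{sl}_2(\mathbb C)\ltimes\mathfrak h$ with $\mathfrak h=\operatorname{Rad}(\mathfrak g)$, and that, as an $\mathfrak{sl}_2(\mathbb C)$-module, $\mathfrak h=V_n\oplus V_m\oplus V_p\oplus V_k$, where $V_s$ denotes a simple module of highest weight $s$ (the four summands are fixed submodules of $\mathfrak h$, and some of the weights $n,m,p,k\in\mathbb N$ may coincide). Write $[U,W]$ for the linear span of the brackets $[u,w]$ with $u\in U$, $w\in W$. Assume that the bracket of any two (equal or distinct) of the four summands is either $0$ or exactly one of the four summands, and that $Z(\mathfrak h)=V_k$. Then $n,m,p,k$ are all even. Moreover, the following holds for each of the six multiplication tables below. A table lists the brackets of the summands; in all of them $[V_p,V_p]=0$ and $V_k$ commutes with every summand, and the remaining entries are as follows. $$\begin{array}{c|ccccc} & [V_n,V_n] & [V_n,V_m] & [V_m,V_m] & [V_n,V_p]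 & [V_m,V_p]\\ \hline (1) & V_p & V_p & V_k & V_k & V_k\\ (2) & V_k & V_p & 0 & V_k & V_k\\ (3) & V_k & V_p & V_k & V_k & V_k\\ (4) & V_p & V_p & V_k & V_k & 0\\ (5) & V_k & V_p & V_k & V_k & 0\\ (6) & V_p & V_k & V_k & V_k & 0 \end{array}$$ If the brackets of the summands of $\mathfrak h$ are given by table (1), (4) or (6), then $p\equiv k\equiv 2 \pmod 4$; if they are given by table (2), (3) or (5), then $k\equiv 2\pmod 4$. In other words, in each table the summands that arise as $[V_s,V_s]$ have highest weight congruent to $2$ modulo $4$. -/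

import Mathlib

namespace Sympathetic

/-- A Lie algebra over `ℂ` is sympathetic if it has trivial centre, is perfect, and all of its
derivations are inner. -/
structure IsSympathetic (𝔤 : Type*) [LieRing 𝔤] [LieAlgebra ℂ 𝔤] : Prop where
  center_eq_bot : LieAlgebra.center ℂ 𝔤 = ⊥
  perfect : ⁅(⊤ : LieIdeal ℂ 𝔤), (⊤ : LieIdeal ℂ 𝔤)⁆ = ⊤
  derivation_inner : ∀ D : LieDerivation ℂ 𝔤 𝔤, ∃ x : 𝔤, ∀ y : 𝔤, D y = ⁅x, y⁆

/-- The Lie algebra `𝔰𝔩₂(ℂ)` of traceless complex `2 × 2` matrices. -/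
abbrev SL2 :=
  LieAlgebra.SpecialLinear.sl (Fin 2) ℂ

/-- The element `H = diag(1, -1)` of `𝔰𝔩₂(ℂ)`. -/
def sl2H : SL2 := LieAlgebra.SpecialLinear.singleSubSingle (0 : Fin 2) 1 (1 : ℂ)

/-- The element `E` of `𝔰𝔩₂(ℂ)`, whose only non-zero entry is a `1` in the upper right corner. -/
def sl2E : SL2 := LieAlgebra.SpecialLinear.single (0 : Fin 2) 1 zero_ne_one (1 : ℂ)

variable {𝔤 : Type*} [LieRing 𝔤] [LieAlgebra ℂ 𝔤]

/-- Let the subalgebra `L` of `𝔤` be identified with `𝔰𝔩₂(ℂ)` by means of `e`. The `L`-submodule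
`V` of `𝔤` is the irreducible representation `V_n` of `𝔰𝔩₂(ℂ)`: it is simple and contains a
highest weight vector of weight `n`. -/
def IsIrrepOfHighestWeight {L : LieSubalgebra ℂ 𝔤} (e : SL2 ≃ₗ⁅ℂ⁆ L)
    (V : LieSubmodule ℂ L 𝔤) (n : ℕ) : Prop :=
  LieModule.IsIrreducible ℂ L V ∧
    ∃ v ∈ V, v ≠ 0 ∧ ⁅e sl2E, v⁆ = 0 ∧ ⁅e sl2H, v⁆ = (n : ℂ) • v

/-- The subspace `[U, W]` of `𝔤` spanned by all brackets `[u, w]` with `u ∈ U` and `w ∈ W`. -/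
def bracket (U W : Submodule ℂ 𝔤) : Submodule ℂ 𝔤 :=
  Submodule.span ℂ {z | ∃ u ∈ U, ∃ w ∈ W, ⁅u, w⁆ = z}

/-- The centre `Z(𝔥)` of a Lie ideal `𝔥` of `𝔤`, as a subspace of `𝔤`. -/
def centerOf (𝔥 : LieIdeal ℂ 𝔤) : Submodule ℂ 𝔤 :=
  (LieAlgebra.center ℂ 𝔥).toSubmodule.map 𝔥.toSubmodule.subtype

/-- `V 0, V 1, V 2, V 3` have the multiplication table `T`: the subspace `[V i, V j]` is `V l` if
the entry of `T` in position `(i, j)` is `some l`, and it is `0` if this entry is `none`. -/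
def HasTable (V : Fin 4 → Submodule ℂ 𝔤) (T : Matrix (Fin 4) (Fin 4) (Option (Fin 4))) : Prop :=
  ∀ i j, bracket (V i) (V j) = (T i j).elim ⊥ V

section Tables

/-- The entry `V_p` of a multiplication table. -/
abbrev P : Option (Fin 4) := some 2

/-- The entry `V_k` of a multiplication table. -/
abbrev K : Option (Fin 4) := some 3

/-- The entry `0` of a multiplication table. -/
abbrev O : Option (Fin 4) := none

/-! The rows and columns of the six tables belong to `V_n, V_m, V_p, V_k`, in this order. -/

def table1 : Matrix (Fin 4) (Fin 4) (Option (Fin 4)) :=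
  !![P, P, K, O;
     P, K, K, O;
     K, K, O, O;
     O, O, O, O]

def table2 : Matrix (Fin 4) (Fin 4) (Option (Fin 4)) :=
  !![K, P, K, O;
     P, O, K, O;
     K, K, O, O;
     O, O, O, O]

def table3 : Matrix (Fin 4) (Fin 4) (Option (Fin 4)) :=
  !![K, P, K, O;
     P, K, K, O;
     K, K, O, O;
     O, O, O, O]

def table4 : Matrix (Fin 4) (Fin 4) (Option (Fin 4)) :=
  !![P, P, K, O;
     P, K, O, O;
     K, O, O, O;
     O, O, O, O]

def table5 : Matrix (Fin 4) (Fin 4) (Option (Fin 4)) :=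
  !![K, P, K, O;
     P, K, O, O;
     K, O, O, O;
     O, O, O, O]

def table6 : Matrix (Fin 4) (Fin 4) (Option (Fin 4)) :=
  !![P, K, K, O;
     K, K, O, O;
     K, O, O, O;
     O, O, O, O]

end Tables

end Sympathetic

/-! ### Combinatorics of the possible multiplication tables. -/

namespace Sympathetic

/-! The algebra is reduced to a finite problem about which bracket of two summands equals which
summand. Three facts feed it. First, perfectness gives $\mathfrak h=[\mathfrak g,\mathfrak h]$, so
by Lie's theorem $\mathfrak h$ acts nilpotently on $\mathfrak g$ (`eq_bot_of_le_bracket_radical`);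
hence the summands can be ordered so that brackets always come later. Second, scalars $c_i$ on the
summands that are additive on all nonzero brackets define a derivation; it is inner and also acts
nilpotently, so it vanishes (`eq_zero_of_grading`). Thus no table admits a nonzero grading. Third,
$V_c=[V_a,V_b]$ forces $c=a+b-2q$, with $q$ odd when the two factors are the same summand, because
the bracket is alternating (`highestWeight_bracket`).

Together with the Jacobi identity and $Z(\mathfrak h)=V_k$, these facts leave a finite check on the
ordered tables that every weight is even (`even_of_ordered`). For a square $V_l=[V_s,V_s]$ with $s$
even, the highest weight of $V_l$ is $2s-2q$ with $q$ odd, which is $2$ modulo $4$ whatever the rest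
of the table. -/

/-- The relation `R i j l` says that the bracket of the `i`-th and the `j`-th of four summands is
the `l`-th one; `w` gives the highest weights and `z` is the summand which is the centre. The
fields collect the constraints satisfied by the radical of a sympathetic Lie algebra. -/
structure IsSympatheticTable (R : Fin 4 → Fin 4 → Fin 4 → Prop) (w : Fin 4 → ℕ) (z : Fin 4) :
    Prop where
  symm : ∀ i j l, R i j l → R j i l
  unique : ∀ i j l l', R i j l → R i j l' → l = l'
  central : ∀ j l, ¬ R z j l
  noncentral : ∀ i, i ≠ z → ∃ j l, R i j l
  nilpotent : ∀ S : Finset (Fin 4), S.Nonempty → ∃ l ∈ S, ∀ i, ∀ j ∈ S, ¬ R i j l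
  grading : ∀ c : Fin 4 → ℤ, (∀ i j l, R i j l → c i + c j = c l) → c = 0
  jacobi : ∀ i j l m q, R i j l → R l m q →
    (∃ l' q', R j m l' ∧ R i l' q') ∨ (∃ l' q', R i m l' ∧ R j l' q')
  weight : ∀ i j l, R i j l → ∃ q, w l + 2 * q = w i + w j ∧ (i = j → Odd q)

namespace IsSympatheticTable

variable {R : Fin 4 → Fin 4 → Fin 4 → Prop} {w : Fin 4 → ℕ} {z : Fin 4}

/-- Renumbering the summands. -/
theorem reindex (h : IsSympatheticTable R w z) (σ : Equiv.Perm (Fin 4)) :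
    IsSympatheticTable (fun i j l => R (σ i) (σ j) (σ l)) (w ∘ σ) (σ.symm z) where
  symm _ _ _ := h.symm _ _ _
  unique i j l l' h₁ h₂ := σ.injective (h.unique _ _ _ _ h₁ h₂)
  central j l := by simpa using h.central _ _
  noncentral i hi := by
    obtain ⟨j, l, hjl⟩ := h.noncentral (σ i) (fun hz => hi (by simp [← hz]))
    exact ⟨σ.symm j, σ.symm l, by simpa using hjl⟩
  nilpotent S hS := by
    obtain ⟨l, hl, hl'⟩ := h.nilpotent (S.map σ.toEmbedding) (by simpa using hS)
    obtain ⟨l, hlS, rfl⟩ := Finset.mem_map.1 hl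
    exact ⟨l, hlS, fun i j hj => hl' _ _ (Finset.mem_map_of_mem _ hj)⟩
  grading c hc := by
    have := h.grading (c ∘ σ.symm) fun i j l hR => by
      simpa using hc (σ.symm i) (σ.symm j) (σ.symm l) (by simpa using hR)
    funext i
    simpa using congrFun this (σ i)
  jacobi i j l m q h₁ h₂ := by
    rcases h.jacobi _ _ _ _ _ h₁ h₂ with ⟨l', q', h₁, h₂⟩ | ⟨l', q', h₁, h₂⟩
    · exact .inl ⟨σ.symm l', σ.symm q', by simpa using h₁, by simpa using h₂⟩
    · exact .inr ⟨σ.symm l', σ.symm q', by simpa using h₁, by simpa using h₂⟩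
  weight i j l hR := by
    obtain ⟨q, h₁, h₂⟩ := h.weight _ _ _ hR
    exact ⟨q, h₁, fun hij => h₂ (by rw [hij])⟩

/-- The summands can be numbered in such a way that the bracket of any two of them comes later
than both of them. -/
theorem exists_ordering (h : IsSympatheticTable R w z) :
    ∃ σ : Equiv.Perm (Fin 4), ∀ i j l, R (σ i) (σ j) (σ l) → i < l ∧ j < l := by
  -- Nilpotency is applied to successive complements: a bracket equal to the newly chosen summand
  -- must have both factors among those already removed.
  obtain ⟨a, -, ha⟩ := h.nilpotent Finset.univ ⟨0, by simp⟩
  obtain ⟨b, hb', hb⟩ := h.nilpotent (Finset.univ \ {a})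
    (by rw [← Finset.card_pos]; clear ha; revert a; decide)
  obtain ⟨c, hc', hc⟩ := h.nilpotent (Finset.univ \ {a, b})
    (by rw [← Finset.card_pos]; clear ha hb hb'; revert a b; decide)
  obtain ⟨d, hd', hd⟩ := h.nilpotent (Finset.univ \ {a, b, c})
    (by rw [← Finset.card_pos]; clear ha hb hb' hc hc'; revert a b c; decide)
  simp only [Finset.mem_sdiff, Finset.mem_univ, Finset.mem_insert, Finset.mem_singleton,
    true_and, not_or] at *
  obtain ⟨hca, hcb⟩ := hc'
  obtain ⟨hda, hdb, hdc⟩ := hd'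
  have hinj : Function.Injective ![a, b, c, d] := by
    intro i j hij
    fin_cases i <;> fin_cases j <;> simp_all [eq_comm]
  refine ⟨Equiv.ofBijective _ (Finite.injective_iff_bijective.1 hinj), ?_⟩
  have key : ∀ i j l, R (![a, b, c, d] i) (![a, b, c, d] j) (![a, b, c, d] l) → j < l := by
    intro i j l hR
    by_contra! hlj
    fin_cases l
    · exact ha _ _ trivial hR
    · refine hb _ _ (fun hj => ?_) hR
      have : j = 0 := hinj hj
      subst this
      exact absurd hlj (by decide)
    · refine hc _ _ ⟨fun hj => ?_, fun hj => ?_⟩ hR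
      · have : j = 0 := hinj hj
        subst this
        exact absurd hlj (by decide)
      · have : j = 1 := hinj hj
        subst this
        exact absurd hlj (by decide)
    · have : j = 3 := le_antisymm (Fin.le_last j) hlj
      subst this
      exact hd _ _ ⟨hda, hdb, hdc⟩ hR
  exact fun i j l hR => ⟨key _ _ _ (h.symm _ _ _ hR), key _ _ _ hR⟩

-- In an ordered table only ten relations can hold. Gradings, Jacobi, uniqueness and noncentrality
-- become propositional constraints on them, the weights contribute congruences, and all cases are
-- checked.
set_option linter.unusedSimpArgs false in
theorem even_of_ordered (h : IsSympatheticTable R w z)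
    (ho : ∀ i j l, R i j l → i < l ∧ j < l) : ∀ i, Even (w i) := by
  have hz : z = 3 := by
    by_contra hz
    obtain ⟨j, l, hR⟩ := h.noncentral 3 (Ne.symm hz)
    exact absurd (ho _ _ _ hR).1 (not_lt.2 (Fin.le_last l))
  subst hz
  have h100 : ∀ l, R 1 0 l ↔ R 0 1 l := fun l => ⟨h.symm _ _ _, h.symm _ _ _⟩
  have h20 : ∀ l, R 2 0 l ↔ R 0 2 l := fun l => ⟨h.symm _ _ _, h.symm _ _ _⟩
  have h21 : ∀ l, R 2 1 l ↔ R 1 2 l := fun l => ⟨h.symm _ _ _, h.symm _ _ _⟩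
  have h0 : ∀ i j, ¬ R i j 0 := fun i j hR => absurd (ho _ _ _ hR).1 (by simp)
  have h3 : ∀ j l, ¬ R 3 j l := h.central
  have h3' : ∀ j l, ¬ R j 3 l := fun j l hR => h3 j l (h.symm _ _ _ hR)
  have h011 : ¬ R 0 1 1 := fun hR => absurd (ho _ _ _ hR).2 (by decide)
  have h111 : ¬ R 1 1 1 := fun hR => absurd (ho _ _ _ hR).2 (by decide)
  have h021 : ¬ R 0 2 1 := fun hR => absurd (ho _ _ _ hR).2 (by decide)
  have h121 : ¬ R 1 2 1 := fun hR => absurd (ho _ _ _ hR).2 (by decide)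
  have h221 : ¬ R 2 2 1 := fun hR => absurd (ho _ _ _ hR).2 (by decide)
  have h022 : ¬ R 0 2 2 := fun hR => absurd (ho _ _ _ hR).2 (by decide)
  have h122 : ¬ R 1 2 2 := fun hR => absurd (ho _ _ _ hR).2 (by decide)
  have h222 : ¬ R 2 2 2 := fun hR => absurd (ho _ _ _ hR).2 (by decide)
  have gr : ∀ c : Fin 4 → ℤ, c ≠ 0 → ¬ ∀ i j l, R i j l → c i + c j = c l :=
    fun c hc hg => hc (h.grading c hg)
  -- Each vector is a nonzero candidate grading, so it excludes every table whose relations all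
  -- respect it.
  have g1 := gr ![1, 1, 1, 2] (by decide)
  have g2 := gr ![1, 1, 2, 3] (by decide)
  have g3 := gr ![1, 2, 3, 4] (by decide)
  have g4 := gr ![1, 2, 2, 3] (by decide)
  have g5 := gr ![1, 0, 1, 2] (by decide)
  have g6 := gr ![0, 1, 1, 2] (by decide)
  have g7 := gr ![2, 1, 2, 3] (by decide)
  have g8 := gr ![2, 1, 3, 4] (by decide)
  have g9 := gr ![2, 3, 4, 6] (by decide)
  have g10 := gr ![2, 4, 3, 6] (by decide)
  have g11 := gr ![3, 2, 4, 6] (by decide)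
  have n0 := h.noncentral 0 (by decide)
  have n1 := h.noncentral 1 (by decide)
  have n2 := h.noncentral 2 (by decide)
  simp [Fin.forall_fin_succ, Fin.exists_fin_succ, h100, h20, h21, h0, h3, h3', h011, h111, h021,
    h121, h221, h022, h122, h222] at g1 g2 g3 g4 g5 g6 g7 g8 g9 g10 g11 n0 n1 n2
  -- The digits are the indices $i,j,l,m,q$ of a nonzero double bracket $[[V_i,V_j],V_m]$, with
  -- $V_l$ the inner bracket and $V_q$ the result.
  have j00102 := h.jacobi 0 0 1 0 2
  have j00103 := h.jacobi 0 0 1 0 3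
  have j00112 := h.jacobi 0 0 1 1 2
  have j00113 := h.jacobi 0 0 1 1 3
  have j00123 := h.jacobi 0 0 1 2 3
  have j00203 := h.jacobi 0 0 2 0 3
  have j00213 := h.jacobi 0 0 2 1 3
  have j00223 := h.jacobi 0 0 2 2 3
  have j01203 := h.jacobi 0 1 2 0 3
  have j01213 := h.jacobi 0 1 2 1 3
  have j01223 := h.jacobi 0 1 2 2 3
  have j11203 := h.jacobi 1 1 2 0 3
  have j11213 := h.jacobi 1 1 2 1 3
  have j11223 := h.jacobi 1 1 2 2 3
  simp [Fin.exists_fin_succ, h100, h20, h21, h0, h3, h3', h011, h111, h021,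
    h121, h221, h022, h122, h222]
    at j00102 j00103 j00112 j00113 j00123 j00203 j00213 j00223 j01203 j01213 j01223 j11203 j11213 j11223
  have u : ∀ i j, (R i j 1 → ¬ R i j 2 ∧ ¬ R i j 3) ∧ (R i j 2 → ¬ R i j 3) := fun i j =>
    ⟨fun h₁ => ⟨fun h₂ => absurd (h.unique _ _ _ _ h₁ h₂) (by decide),
      fun h₂ => absurd (h.unique _ _ _ _ h₁ h₂) (by decide)⟩,
      fun h₁ h₂ => absurd (h.unique _ _ _ _ h₁ h₂) (by decide)⟩
  have u00 := u 0 0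
  have u01 := u 0 1
  have u11 := u 1 1
  have par : ∀ i j l, R i j l → (w l + w i + w j) % 2 = 0 := fun i j l hR => by
    obtain ⟨q, hq, -⟩ := h.weight i j l hR
    lia
  -- Here $w_l=2w_i-2q$ with $q$ odd, so $w_l\equiv 2w_i+2$ modulo $4$; in particular $w_l$ is even.
  have sq : ∀ i l, R i i l → (w l + 2 + 2 * w i) % 4 = 0 := fun i l hR => by
    obtain ⟨q, hq, hodd⟩ := h.weight i i l hR
    obtain ⟨r, rfl⟩ := hodd rfl
    lia
  have p012 := par 0 1 2
  have p013 := par 0 1 3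
  have p023 := par 0 2 3
  have p123 := par 1 2 3
  have s001 := sq 0 1
  have s002 := sq 0 2
  have s003 := sq 0 3
  have s112 := sq 1 2
  have s113 := sq 1 3
  have s223 := sq 2 3
  simp [Fin.forall_fin_succ, Nat.even_iff]
  clear gr u par sq ho h h0 h3 h3' h100 h20 h21 h011 h111 h021 h121 h221 h022 h122 h222
  generalize R 0 0 1 = r001 at *
  generalize R 0 0 2 = r002 at *
  generalize R 0 0 3 = r003 at *
  generalize R 0 1 2 = r012 at *
  generalize R 0 1 3 = r013 at *
  generalize R 1 1 2 = r112 at *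
  generalize R 1 1 3 = r113 at *
  generalize R 0 2 3 = r023 at *
  generalize R 1 2 3 = r123 at *
  generalize R 2 2 3 = r223 at *
  generalize w 0 = w0 at *
  generalize w 1 = w1 at *
  generalize w 2 = w2 at *
  generalize w 3 = w3 at *
  by_cases c1 : r001 <;> by_cases c2 : r002 <;> by_cases c3 : r003 <;>
    simp only [c1, c2, c3, not_true_eq_false, not_false_eq_true, false_and, true_and, true_or,
      false_or, true_imp_iff, false_imp_iff] at * <;>
    by_cases c4 : r012 <;> by_cases c5 : r013 <;> by_cases c6 : r112 <;> by_cases c7 : r113 <;>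
    (try simp only [c4, c5, c6, c7, not_true_eq_false, not_false_eq_true, false_and, and_false,
      true_and, true_or, or_true, false_or, or_false, true_imp_iff, false_imp_iff] at *) <;>
    by_cases c8 : r023 <;> by_cases c9 : r123 <;> by_cases c10 : r223 <;>
    (try simp only [c8, c9, c10, not_true_eq_false, not_false_eq_true, and_false, and_true, or_true,
      or_false, true_imp_iff, false_imp_iff] at *) <;>
    omega

theorem even (h : IsSympatheticTable R w z) (i : Fin 4) : Even (w i) := by
  obtain ⟨σ, hσ⟩ := h.exists_ordering
  simpa using (h.reindex σ).even_of_ordered hσ (σ.symm i)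

end IsSympatheticTable
end Sympathetic

/-! ### Representations of $\mathfrak{sl}_2$ and highest weights of brackets. -/

namespace Sympathetic

/-- The element `F` of `𝔰𝔩₂(ℂ)`, whose only non-zero entry is a `1` in the lower left corner. -/
def sl2F : SL2 := LieAlgebra.SpecialLinear.single (1 : Fin 2) 0 one_ne_zero (1 : ℂ)

theorem isSl2Triple : IsSl2Triple sl2H sl2E sl2F where
  h_ne_zero h := by
    have := congrFun (congrFun (congrArg Subtype.val h) 0) 0
    simp [sl2H] at this
  lie_e_f := by
    ext i j
    simp only [sl2H, sl2E, sl2F, LieSubalgebra.coe_bracket, Ring.lie_def]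
    fin_cases i <;> fin_cases j <;> simp
  lie_h_e_nsmul := by
    ext i j
    simp only [sl2H, sl2E, LieSubalgebra.coe_bracket, Ring.lie_def]
    fin_cases i <;> fin_cases j <;> simp [Matrix.mul_apply]
    norm_num
  lie_h_f_nsmul := by
    ext i j
    simp only [sl2H, sl2F, LieSubalgebra.coe_bracket, Ring.lie_def]
    fin_cases i <;> fin_cases j <;> simp [Matrix.mul_apply]
    norm_num

theorem sl2_eq_combination (x : SL2) : ∃ a b c : ℂ, x = a • sl2E + b • sl2H + c • sl2F := by
  have hx : x.val 0 0 + x.val 1 1 = 0 := by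
    have : Matrix.trace x.val = 0 := x.2
    simpa [Matrix.trace, Fin.sum_univ_two] using this
  refine ⟨x.val 0 1, x.val 0 0, x.val 1 0, ?_⟩
  ext i j
  fin_cases i <;> fin_cases j <;> simp [sl2E, sl2H, sl2F]
  linear_combination hx

theorem sl2_eq_zero_of_lie_eq_zero {x : SL2} (h : ∀ y : SL2, ⁅x, y⁆ = 0) : x = 0 := by
  have hx : x.val 0 0 + x.val 1 1 = 0 := by
    have : Matrix.trace x.val = 0 := x.2
    simpa [Matrix.trace, Fin.sum_univ_two] using this
  have hE : ∀ i j, (⁅x, sl2E⁆ : SL2).val i j = 0 := fun i j => by rw [h]; rfl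
  have hF : ∀ i j, (⁅x, sl2F⁆ : SL2).val i j = 0 := fun i j => by rw [h]; rfl
  have h1 := hE 0 0
  have h2 := hE 0 1
  have h3 := hF 0 0
  simp [sl2E, sl2F, Ring.lie_def, Matrix.mul_apply] at h1 h2 h3
  ext i j
  fin_cases i <;> fin_cases j <;> simp
  all_goals first | assumption | linear_combination (hx + h2) / 2 | linear_combination (hx - h2) / 2

variable {𝔤 : Type*} [LieRing 𝔤] [LieAlgebra ℂ 𝔤] {L : LieSubalgebra ℂ 𝔤} {e : SL2 ≃ₗ⁅ℂ⁆ L}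

theorem isSl2Triple_map (e : SL2 ≃ₗ⁅ℂ⁆ L) : IsSl2Triple (e sl2H) (e sl2E) (e sl2F) where
  h_ne_zero h := isSl2Triple.h_ne_zero (e.injective (by simpa using h))
  lie_e_f := by rw [← isSl2Triple.lie_e_f, LieEquiv.map_lie]
  lie_h_e_nsmul := by rw [← LieEquiv.map_lie, isSl2Triple.lie_h_e_nsmul, map_nsmul]
  lie_h_f_nsmul := by rw [← LieEquiv.map_lie, isSl2Triple.lie_h_f_nsmul, map_neg, map_nsmul]

/-- The vectors `F ^ r v`. -/
def lower (e : SL2 ≃ₗ⁅ℂ⁆ L) (v : 𝔤) (r : ℕ) : 𝔤 := ((LieModule.toEnd ℂ L 𝔤 (e sl2F)) ^ r) v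

theorem lower_zero (v : 𝔤) : lower e v 0 = v := by simp [lower]

theorem lie_F_lower (v : 𝔤) (r : ℕ) : ⁅e sl2F, lower e v r⁆ = lower e v (r + 1) := by
  simp [lower, pow_succ']

theorem lie_H_lower {v : 𝔤} {μ : ℂ} (h : ⁅e sl2H, v⁆ = μ • v) (r : ℕ) :
    ⁅e sl2H, lower e v r⁆ = (μ - 2 * r) • lower e v r := by
  induction r with
  | zero => simpa [lower_zero] using h
  | succ r ih =>
    rw [← lie_F_lower, leibniz_lie, ih, lie_smul, (isSl2Triple_map e).lie_h_f_nsmul, neg_lie,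
      nsmul_lie]
    push_cast
    module

/-- An irreducible representation of highest weight `n` is spanned by the vectors `F ^ r v`, where
`v` is a highest weight vector. -/
theorem IsIrrepOfHighestWeight.exists_eq_span {V : LieSubmodule ℂ L 𝔤} {n : ℕ}
    (hV : IsIrrepOfHighestWeight e V n) :
    ∃ v : 𝔤, v ≠ 0 ∧ ⁅e sl2H, v⁆ = (n : ℂ) • v ∧
      V.toSubmodule = Submodule.span ℂ (Set.range (lower e v)) := by
  obtain ⟨hirr, v, hvV, hv0, hE, hH⟩ := hV
  refine ⟨v, hv0, hH, ?_⟩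
  have P : (isSl2Triple_map e).HasPrimitiveVectorWith v (n : ℂ) := ⟨hv0, hH, hE⟩
  have hlow : ∀ r, lower e v r ∈ V := fun r => by
    induction r with
    | zero => simpa [lower_zero] using hvV
    | succ r ih => rw [← lie_F_lower]; exact V.lie_mem ih
  have hstab : ∀ (x : L) (y : 𝔤), y ∈ Submodule.span ℂ (Set.range (lower e v)) →
      ⁅x, y⁆ ∈ Submodule.span ℂ (Set.range (lower e v)) := by
    intro x y hy
    obtain ⟨x, rfl⟩ : ∃ x', e x' = x := ⟨e.symm x, e.apply_symm_apply x⟩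
    obtain ⟨a, b, c, rfl⟩ := sl2_eq_combination x
    have hmem : ∀ r, lower e v r ∈ Submodule.span ℂ (Set.range (lower e v)) :=
      fun r => Submodule.subset_span ⟨r, rfl⟩
    induction hy using Submodule.span_induction with
    | zero => simp
    | add y z _ _ h₁ h₂ => rw [lie_add]; exact add_mem h₁ h₂
    | smul t y _ h => rw [lie_smul]; exact Submodule.smul_mem _ _ h
    | mem y hy =>
      obtain ⟨r, rfl⟩ := hy
      rw [map_add, map_add, map_smul, map_smul, map_smul, add_lie, add_lie, smul_lie, smul_lie,
        smul_lie]
      refine add_mem (add_mem ?_ ?_) ?_ <;> apply Submodule.smul_mem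
      · cases r with
        | zero => simp [lower_zero, hE]
        | succ r =>
          have := P.lie_e_pow_succ_toEnd_f r
          rw [lower, this]
          exact Submodule.smul_mem _ _ (hmem r)
      · rw [lie_H_lower hH]
        exact Submodule.smul_mem _ _ (hmem r)
      · rw [lie_F_lower]
        exact hmem _
  let N : LieSubmodule ℂ L 𝔤 :=
    { Submodule.span ℂ (Set.range (lower e v)) with lie_mem := fun h => hstab _ _ h }
  have hNV : N ≤ V := by
    rw [← LieSubmodule.toSubmodule_le_toSubmodule]
    exact Submodule.span_le.2 (by rintro _ ⟨r, rfl⟩; exact hlow r)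
  have hvN : v ∈ N := Submodule.subset_span ⟨0, lower_zero v⟩
  have htop : N.comap V.incl = ⊤ := by
    refine (eq_bot_or_eq_top (N.comap V.incl)).resolve_left fun hbot => hv0 ?_
    have : (⟨v, hvV⟩ : V) ∈ N.comap V.incl := hvN
    rw [hbot, LieSubmodule.mem_bot] at this
    exact congrArg Subtype.val this
  have hVN : V ≤ N := fun y hy => by
    have : (⟨y, hy⟩ : V) ∈ N.comap V.incl := htop ▸ LieSubmodule.mem_top _
    exact this
  exact congrArg LieSubmodule.toSubmodule (le_antisymm hVN hNV)

/-- A functional on an irreducible representation which reads off the coefficient of a highest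
weight vector. -/
theorem IsIrrepOfHighestWeight.exists_functional {V : LieSubmodule ℂ L 𝔤} {n : ℕ}
    (hV : IsIrrepOfHighestWeight e V n) :
    ∃ φ : 𝔤 →ₗ[ℂ] ℂ, (∃ z ∈ V, φ z ≠ 0) ∧
      ∀ y ∈ V, φ ⁅e sl2F, y⁆ = 0 ∧ φ ⁅e sl2H, y⁆ = n * φ y := by
  obtain ⟨v, hv0, hH, hspan⟩ := hV.exists_eq_span
  set T : Module.End ℂ 𝔤 := LieModule.toEnd ℂ L 𝔤 (e sl2H)
  -- The vectors $F^{r+1}v$ have $H$-eigenvalues $n-2(r+1)\ne n$, and eigenspaces are independent,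
  -- so some functional kills $W$ but not $v$.
  set W : Submodule ℂ 𝔤 := ⨆ (μ : ℂ) (_ : μ ≠ n), T.eigenspace μ
  have hvW : v ∉ W := fun hvW => hv0 <| by
    have hd : Disjoint (T.eigenspace (n : ℂ)) W := T.eigenspaces_iSupIndep (n : ℂ)
    exact Submodule.disjoint_def.1 hd v (Module.End.mem_eigenspace_iff.2 hH) hvW
  have hlow : ∀ r, lower e v (r + 1) ∈ W := fun r => by
    refine Submodule.mem_iSup_of_mem ((n : ℂ) - 2 * ((r + 1 : ℕ) : ℂ))
      (Submodule.mem_iSup_of_mem ?_ (Module.End.mem_eigenspace_iff.2 (lie_H_lower hH _)))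
    rw [Ne, sub_eq_self, mul_eq_zero, not_or]
    exact ⟨two_ne_zero, Nat.cast_ne_zero.2 r.succ_ne_zero⟩
  obtain ⟨φ, hφv, hφW⟩ := Submodule.exists_le_ker_of_notMem hvW
  have hlow' : ∀ r, φ (lower e v (r + 1)) = 0 := fun r => hφW (hlow r)
  refine ⟨φ, ⟨v, ?_, hφv⟩, fun y hy => ?_⟩
  · rw [← LieSubmodule.mem_toSubmodule, hspan]
    exact Submodule.subset_span ⟨0, lower_zero v⟩
  rw [← LieSubmodule.mem_toSubmodule, hspan] at hy
  induction hy using Submodule.span_induction with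
  | zero => simp
  | add y z _ _ h₁ h₂ => rw [lie_add, lie_add, map_add, map_add, map_add, h₁.1, h₁.2, h₂.1,
      h₂.2, mul_add, add_zero]; exact ⟨rfl, rfl⟩
  | smul t y _ h => rw [lie_smul, lie_smul, map_smul, map_smul, map_smul, h.1, h.2,
      smul_zero, smul_eq_mul, smul_eq_mul, mul_left_comm]; exact ⟨rfl, rfl⟩
  | mem y hy =>
    obtain ⟨r, rfl⟩ := hy
    rw [lie_F_lower, lie_H_lower hH, map_smul]
    refine ⟨hlow' r, ?_⟩
    cases r with
    | zero => simp
    | succ r => simp [hlow']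

/-- If the bracket of two irreducible representations of highest weights `a` and `b` is irreducible
of highest weight `c`, then `c = a + b - 2 * q` for some `q`, and `q` is odd if the two
representations are equal. -/
theorem highestWeight_bracket {V W U : LieSubmodule ℂ L 𝔤} {a b c : ℕ}
    (hV : IsIrrepOfHighestWeight e V a) (hW : IsIrrepOfHighestWeight e W b)
    (hU : IsIrrepOfHighestWeight e U c)
    (h : bracket V.toSubmodule W.toSubmodule = U.toSubmodule) :
    ∃ q, c + 2 * q = a + b ∧ (V = W → a = b → Odd q) := by
  obtain ⟨φ, ⟨z, hzU, hφz⟩, hφ⟩ := hU.exists_functional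
  obtain ⟨v, -, hHv, hVspan⟩ := hV.exists_eq_span
  -- The generator of the second factor is left arbitrary so that $v$ itself can serve when $V=W$,
  -- as the parity argument needs.
  have key : ∀ w : 𝔤, ⁅e sl2H, w⁆ = (b : ℂ) • w →
      W.toSubmodule = Submodule.span ℂ (Set.range (lower e w)) →
      ∃ q, c + 2 * q = a + b ∧ (v = w → Odd q) := by
    intro w hHw hWspan
    have hmem : ∀ r s, ⁅lower e v r, lower e w s⁆ ∈ U := fun r s => by
      rw [← LieSubmodule.mem_toSubmodule, ← h]
      refine Submodule.subset_span ⟨_, ?_, _, ?_, rfl⟩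
      · rw [hVspan]; exact Submodule.subset_span ⟨r, rfl⟩
      · rw [hWspan]; exact Submodule.subset_span ⟨s, rfl⟩
    have hleib : ∀ (x : L) (y y' : 𝔤), ⁅x, ⁅y, y'⁆⁆ = ⁅⁅x, y⁆, y'⁆ + ⁅y, ⁅x, y'⁆⁆ :=
      fun x y y' => leibniz_lie (x : 𝔤) y y'
    have hF : ∀ r s, φ ⁅lower e v (r + 1), lower e w s⁆ = - φ ⁅lower e v r, lower e w (s + 1)⁆ :=
      fun r s => by
        have := (hφ _ (hmem r s)).1
        rw [hleib, lie_F_lower, lie_F_lower, map_add] at this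
        exact eq_neg_of_add_eq_zero_left this
    -- Since $\varphi$ kills $FU$, the form $\varphi([x,y])$ lets $F$ pass from one factor to the
    -- other at the cost of a sign.
    have hF' : ∀ r s, φ ⁅lower e v r, lower e w s⁆ = (-1) ^ r * φ ⁅v, lower e w (r + s)⁆ := by
      intro r
      induction r with
      | zero => intro s; simp [lower_zero]
      | succ r ih => intro s; rw [hF, ih, pow_succ, show r + (s + 1) = r + 1 + s by ring]; ring
    obtain ⟨r, s, hrs⟩ : ∃ r s, φ ⁅lower e v r, lower e w s⁆ ≠ 0 := by
      by_contra! h0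
      refine hφz ?_
      have hle : bracket V.toSubmodule W.toSubmodule ≤ LinearMap.ker φ := by
        refine Submodule.span_le.2 ?_
        rintro _ ⟨x, hx, y, hy, rfl⟩
        rw [hVspan] at hx
        rw [hWspan] at hy
        change φ ⁅x, y⁆ = 0
        induction hx using Submodule.span_induction with
        | zero => simp
        | add x x' _ _ h₁ h₂ => rw [add_lie, map_add, h₁, h₂, add_zero]
        | smul t x _ h => rw [smul_lie, map_smul, h, smul_zero]
        | mem x hx =>
          obtain ⟨r, rfl⟩ := hx
          induction hy using Submodule.span_induction with
          | zero => simp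
          | add x x' _ _ h₁ h₂ => rw [lie_add, map_add, h₁, h₂, add_zero]
          | smul t x _ h => rw [lie_smul, map_smul, h, smul_zero]
          | mem y hy =>
            obtain ⟨s, rfl⟩ := hy
            exact h0 r s
      rw [h] at hle
      exact hle hzU
    -- A nonzero value of $\varphi$ lives only in weight $c$, while the bracket has weight
    -- $a+b-2(r+s)$.
    refine ⟨r + s, ?_, ?_⟩
    · have := (hφ _ (hmem r s)).2
      rw [hleib, lie_H_lower hHv, lie_H_lower hHw, smul_lie, lie_smul, ← add_smul, map_smul,
        smul_eq_mul] at this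
      have := mul_right_cancel₀ hrs this
      have h' : ((c + 2 * (r + s) : ℕ) : ℂ) = ((a + b : ℕ) : ℂ) := by
        push_cast
        linear_combination -this
      exact_mod_cast h'
    · rintro rfl
      by_contra hodd
      -- For $r+s=2t$, every value equals, up to sign, $\varphi([F^tv,F^tv])=0$.
      obtain ⟨t, ht⟩ := Nat.not_odd_iff_even.1 hodd
      have h1 := hF' t t
      rw [lie_self, map_zero] at h1
      have h2 : φ ⁅v, lower e v (t + t)⁆ = 0 := by
        rcases mul_eq_zero.1 h1.symm with h | h
        · exact absurd h (pow_ne_zero _ (by norm_num))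
        · exact h
      rw [hF', ht, h2, mul_zero] at hrs
      exact hrs rfl
  by_cases hVW : V = W
  · subst hVW
    by_cases hab : a = b
    · subst hab
      obtain ⟨q, h₁, h₂⟩ := key v hHv hVspan
      exact ⟨q, h₁, fun _ _ => h₂ rfl⟩
    · obtain ⟨w, -, hHw, hWspan⟩ := hW.exists_eq_span
      obtain ⟨q, h₁, -⟩ := key w hHw hWspan
      exact ⟨q, h₁, fun _ h => absurd h hab⟩
  · obtain ⟨w, -, hHw, hWspan⟩ := hW.exists_eq_span
    obtain ⟨q, h₁, -⟩ := key w hHw hWspan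
    exact ⟨q, h₁, fun h => absurd h hVW⟩

end Sympathetic

/-! ### Nilpotent action of the radical. -/

namespace Sympathetic

open LieAlgebra LieModule

variable {𝔤 : Type*} [LieRing 𝔤] [LieAlgebra ℂ 𝔤] {L : LieSubalgebra ℂ 𝔤} {e : SL2 ≃ₗ⁅ℂ⁆ L}

/-- If a perfect Lie algebra is the sum of its radical and a subalgebra which intersects the radical
trivially, then its radical is `[𝔤, Rad(𝔤)]`. -/
theorem lie_top_radical_eq (hperf : ⁅(⊤ : LieIdeal ℂ 𝔤), (⊤ : LieIdeal ℂ 𝔤)⁆ = ⊤)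
    (hL : IsCompl L.toSubmodule (radical ℂ 𝔤).toSubmodule) :
    ⁅(⊤ : LieIdeal ℂ 𝔤), radical ℂ 𝔤⁆ = radical ℂ 𝔤 := by
  set N := ⁅(⊤ : LieIdeal ℂ 𝔤), radical ℂ 𝔤⁆
  have hN : N ≤ radical ℂ 𝔤 := LieSubmodule.lie_le_right _ _
  refine le_antisymm hN fun u hu => ?_
  -- Expanding brackets along $\mathfrak g=L+\mathfrak h$ shows $\mathfrak g=[\mathfrak g,\mathfrak
  -- g]\subseteq L+[\mathfrak g,\mathfrak h]$.
  have hmem : ∀ x : 𝔤, x ∈ L.toSubmodule ⊔ N.toSubmodule := fun x => by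
    have hx : x ∈ (⁅(⊤ : LieIdeal ℂ 𝔤), (⊤ : LieIdeal ℂ 𝔤)⁆).toSubmodule := by
      rw [hperf]; trivial
    rw [LieSubmodule.lieIdeal_oper_eq_linear_span'] at hx
    refine (Submodule.span_le.2 ?_ : _ ≤ L.toSubmodule ⊔ N.toSubmodule) hx
    rintro _ ⟨y, -, z, -, rfl⟩
    have htop : ∀ t : 𝔤, ∃ s ∈ L, ∃ v ∈ radical ℂ 𝔤, s + v = t := fun t =>
      Submodule.mem_sup.1 (hL.sup_eq_top ▸ Submodule.mem_top)
    obtain ⟨s, hs, v, hv, rfl⟩ := htop y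
    obtain ⟨s', hs', v', hv', rfl⟩ := htop z
    rw [add_lie, lie_add, lie_add, add_assoc]
    refine Submodule.add_mem_sup (L.lie_mem hs hs') ?_
    refine add_mem (LieSubmodule.lie_mem_lie (by trivial) hv')
      (add_mem ?_ (LieSubmodule.lie_mem_lie (by trivial) hv'))
    rw [← lie_skew]
    exact neg_mem (LieSubmodule.lie_mem_lie (by trivial) hv)
  obtain ⟨s, hs, v, hv, hsv⟩ := Submodule.mem_sup.1 (hmem u)
  have hs0 : s = 0 := by
    refine Submodule.disjoint_def.1 hL.disjoint s hs ?_
    rw [← add_sub_cancel_right s v, hsv]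
    exact sub_mem hu (hN hv)
  rwa [← hsv, hs0, zero_add]

variable [FiniteDimensional ℂ 𝔤]

/-- A nonzero representation of `𝔤` contains a nonzero vector which is killed by `[𝔤, Rad(𝔤)]`. -/
theorem exists_ne_zero_lie_eq_zero (hrad : ⁅(⊤ : LieIdeal ℂ 𝔤), radical ℂ 𝔤⁆ = radical ℂ 𝔤)
    (M : Type*) [AddCommGroup M] [Module ℂ M] [LieRingModule 𝔤 M] [LieModule ℂ 𝔤 M]
    [FiniteDimensional ℂ M] [Nontrivial M] :
    ∃ m : M, m ≠ 0 ∧ ∀ x ∈ radical ℂ 𝔤, ⁅x, m⁆ = 0 := by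
  -- By Lie's theorem the radical has a common eigenspace, and it is $\mathfrak g$-stable. There
  -- $[y,u]$ acts as the commutator of $y$ with a scalar, hence as zero.
  obtain ⟨χ, hχ⟩ : ∃ χ : Module.Dual ℂ (radical ℂ 𝔤), Nontrivial (weightSpace M χ) :=
    exists_nontrivial_weightSpace_of_isSolvable ℂ (radical ℂ 𝔤) M
  let N : LieSubmodule ℂ 𝔤 M := weightSpaceOfIsLieTower ℂ M χ
  have hN : ∀ m ∈ N, ∀ (x : 𝔤) (hx : x ∈ radical ℂ 𝔤), ⁅x, m⁆ = χ ⟨x, hx⟩ • m :=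
    fun m hm x hx => (mem_weightSpace χ m).1 hm ⟨x, hx⟩
  obtain ⟨⟨m, hm⟩, hm0⟩ := exists_ne (0 : weightSpace M χ)
  have hmN : m ∈ N := hm
  refine ⟨m, fun h => hm0 (Subtype.ext h), fun x hx => ?_⟩
  rw [← hrad, ← LieSubmodule.mem_toSubmodule, LieSubmodule.lieIdeal_oper_eq_linear_span'] at hx
  induction hx using Submodule.span_induction with
  | zero => simp
  | add x y _ _ h₁ h₂ => rw [add_lie, h₁, h₂, add_zero]
  | smul t x _ h => rw [smul_lie, h, smul_zero]
  | mem x hx =>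
    obtain ⟨y, -, u, hu, rfl⟩ := hx
    rw [lie_lie, hN m hmN u hu, hN _ (N.lie_mem hmN) u hu, lie_smul, sub_self]

/-- The radical acts nilpotently on `𝔤`: there is no nonzero ideal `J` with `J ⊆ [Rad(𝔤), J]`. -/
theorem eq_bot_of_le_radical_lie (hrad : ⁅(⊤ : LieIdeal ℂ 𝔤), radical ℂ 𝔤⁆ = radical ℂ 𝔤)
    {J : LieSubmodule ℂ 𝔤 𝔤} (hJ : J ≤ ⁅radical ℂ 𝔤, J⁆) : J = ⊥ := by
  by_contra hbot
  have : Nontrivial J := (LieSubmodule.nontrivial_iff_ne_bot ℂ 𝔤 𝔤).2 hbot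
  -- In the dual of $J$, a functional killed by the radical vanishes on $[\mathfrak h,J]\supseteq
  -- J$.
  obtain ⟨f, hf0, hf⟩ := exists_ne_zero_lie_eq_zero hrad (Module.Dual ℂ J)
  refine hf0 (LinearMap.ext fun ⟨y, hy⟩ => ?_)
  have hle : ⁅radical ℂ 𝔤, J⁆.toSubmodule ≤ (LinearMap.ker f).map J.toSubmodule.subtype := by
    rw [LieSubmodule.lieIdeal_oper_eq_linear_span']
    refine Submodule.span_le.2 ?_
    rintro _ ⟨x, hx, n, hn, rfl⟩
    have hker : f ⁅x, (⟨n, hn⟩ : J)⁆ = 0 := by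
      have := LinearMap.congr_fun (hf x hx) ⟨n, hn⟩
      simpa [LieHom.lie_apply] using this
    exact ⟨_, hker, rfl⟩
  obtain ⟨y', hy', rfl⟩ := hle (hJ hy)
  exact hy'

/-- The ideal generated by $X$ inherits the inclusion. Allowing arbitrary subspaces covers both
partial sums of summands and lines spanned by eigenvectors. -/
theorem eq_bot_of_le_bracket_radical
    (hrad : ⁅(⊤ : LieIdeal ℂ 𝔤), radical ℂ 𝔤⁆ = radical ℂ 𝔤) {X : Submodule ℂ 𝔤}
    (hX : X ≤ bracket (radical ℂ 𝔤).toSubmodule X) : X = ⊥ := by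
  set J : LieSubmodule ℂ 𝔤 𝔤 := LieSubmodule.lieSpan ℂ 𝔤 (X : Set 𝔤)
  have hXJ : X ≤ J.toSubmodule := LieSubmodule.subset_lieSpan
  have hJ : J = ⊥ := by
    refine eq_bot_of_le_radical_lie hrad (LieSubmodule.lieSpan_le.2 fun x hx => ?_)
    refine (Submodule.span_le.2 ?_ : _ ≤ ⁅radical ℂ 𝔤, J⁆.toSubmodule) (hX hx)
    rintro _ ⟨u, hu, y, hy, rfl⟩
    exact LieSubmodule.lie_mem_lie hu (hXJ hy)
  rw [eq_bot_iff]
  intro x hx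
  have := hXJ hx
  rw [hJ] at this
  exact this

end Sympathetic

/-! ### Derivations from gradings, and the constraints on the table. -/

namespace Sympathetic

open LieAlgebra LieModule

/-- There is a linear map which acts by given scalars on given independent subspaces and vanishes on
a complement of their sum. -/
theorem exists_linearMap_eq_smul {ι E : Type*} [DecidableEq ι] [AddCommGroup E] [Module ℂ E]
    {p q : Submodule ℂ E} {V : ι → Submodule ℂ E} (hpq : IsCompl p q) (hV : iSupIndep V)
    (hle : ∀ i, V i ≤ q) (c : ι → ℂ) :
    ∃ D : E →ₗ[ℂ] E, (∀ x ∈ p, D x = 0) ∧ ∀ i, ∀ x ∈ V i, D x = c i • x := by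
  obtain ⟨g, hg⟩ := LinearMap.exists_leftInverse_of_injective
    (DFinsupp.lsum ℂ fun i => (V i).subtype) (LinearMap.ker_eq_bot.2 hV.dfinsupp_lsum_injective)
  refine ⟨(DFinsupp.lsum ℂ fun i => c i • (V i).subtype) ∘ₗ g ∘ₗ
    LinearMap.ofIsCompl hpq 0 q.subtype, fun x hx => ?_, fun i x hx => ?_⟩
  · have := LinearMap.ofIsCompl_apply_left hpq (φ := 0) (ψ := q.subtype) ⟨x, hx⟩
    simp only [LinearMap.zero_apply] at this
    simp [this]
  · have h₁ := LinearMap.ofIsCompl_apply_right hpq (φ := 0) (ψ := q.subtype) ⟨x, hle i hx⟩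
    simp only [Submodule.subtype_apply] at h₁
    have h₂ := LinearMap.congr_fun hg (DFinsupp.single i ⟨x, hx⟩)
    simp only [LinearMap.comp_apply, DFinsupp.lsum_single, Submodule.subtype_apply,
      LinearMap.id_apply] at h₂
    simp [h₁, h₂]

variable {𝔤 : Type*} [LieRing 𝔤] [LieAlgebra ℂ 𝔤]

theorem lie_mem_bracket {U W : Submodule ℂ 𝔤} {u w : 𝔤} (hu : u ∈ U) (hw : w ∈ W) :
    ⁅u, w⁆ ∈ bracket U W :=
  Submodule.subset_span ⟨u, hu, w, hw, rfl⟩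

theorem lie_eq_zero_of_bracket_eq_bot {U W : Submodule ℂ 𝔤} (h : bracket U W = ⊥) {u w : 𝔤}
    (hu : u ∈ U) (hw : w ∈ W) : ⁅u, w⁆ = 0 :=
  (Submodule.mem_bot ℂ).1 (h ▸ lie_mem_bracket hu hw)

theorem bracket_eq_bot {U W : Submodule ℂ 𝔤} (h : ∀ u ∈ U, ∀ w ∈ W, ⁅u, w⁆ = 0) :
    bracket U W = ⊥ := by
  refine (Submodule.eq_bot_iff _).2 fun x hx => ?_
  refine (Submodule.span_le.2 ?_ : bracket U W ≤ ⊥) hx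
  rintro _ ⟨u, hu, w, hw, rfl⟩
  exact h u hu w hw

theorem bracket_mono {U U' W W' : Submodule ℂ 𝔤} (hU : U ≤ U') (hW : W ≤ W') :
    bracket U W ≤ bracket U' W' := by
  refine Submodule.span_le.2 ?_
  rintro _ ⟨u, hu, w, hw, rfl⟩
  exact lie_mem_bracket (hU hu) (hW hw)

theorem bracket_comm (U W : Submodule ℂ 𝔤) : bracket U W = bracket W U := by
  have : ∀ U W : Submodule ℂ 𝔤, bracket U W ≤ bracket W U := fun U W => by
    refine Submodule.span_le.2 ?_
    rintro _ ⟨u, hu, w, hw, rfl⟩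
    rw [← lie_skew]
    exact neg_mem (lie_mem_bracket hw hu)
  exact le_antisymm (this U W) (this W U)

variable {L : LieSubalgebra ℂ 𝔤} {e : SL2 ≃ₗ⁅ℂ⁆ L}

theorem IsIrrepOfHighestWeight.ne_bot {V : LieSubmodule ℂ L 𝔤} {n : ℕ}
    (hV : IsIrrepOfHighestWeight e V n) : V.toSubmodule ≠ ⊥ := by
  obtain ⟨-, v, hv, hv0, -⟩ := hV
  exact fun h => hv0 ((Submodule.mem_bot ℂ).1 (h ▸ hv))

theorem lie_eq_zero_of_mem_centerOf {x y : 𝔤} (hx : x ∈ centerOf (radical ℂ 𝔤))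
    (hy : y ∈ radical ℂ 𝔤) : ⁅x, y⁆ = 0 := by
  obtain ⟨x, hx, rfl⟩ := hx
  have := (mem_maxTrivSubmodule ℂ (radical ℂ 𝔤) (radical ℂ 𝔤) x).1 hx ⟨y, hy⟩
  rw [← lie_skew, neg_eq_zero]
  exact congrArg Subtype.val this

theorem mem_centerOf {x : 𝔤} (hx : x ∈ radical ℂ 𝔤) (h : ∀ y ∈ radical ℂ 𝔤, ⁅y, x⁆ = 0) :
    x ∈ centerOf (radical ℂ 𝔤) :=
  ⟨⟨x, hx⟩, (mem_maxTrivSubmodule ℂ (radical ℂ 𝔤) (radical ℂ 𝔤) _).2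
    fun y => Subtype.ext (h y y.2), rfl⟩

variable [FiniteDimensional ℂ 𝔤]

/-- Let `V` be independent `L`-submodules which span the radical. If scalars `c` are compatible with
the brackets of these submodules then they vanish, since they define a derivation of `𝔤`. -/
theorem eq_zero_of_grading {ι : Type*} [DecidableEq ι] (hsymp : IsSympathetic 𝔤)
    (e : SL2 ≃ₗ⁅ℂ⁆ L) (hLevi : IsCompl L.toSubmodule (radical ℂ 𝔤).toSubmodule)
    {V : ι → LieSubmodule ℂ L 𝔤} (hne : ∀ i, (V i).toSubmodule ≠ ⊥)
    (hindep : iSupIndep fun i => (V i).toSubmodule)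
    (hsum : ⨆ i, (V i).toSubmodule = (radical ℂ 𝔤).toSubmodule) {c : ι → ℂ}
    (hc : ∀ i j, bracket (V i).toSubmodule (V j).toSubmodule = ⊥ ∨
      ∃ l, bracket (V i).toSubmodule (V j).toSubmodule = (V l).toSubmodule ∧ c i + c j = c l)
    (i : ι) : c i = 0 := by
  have hle : ∀ i, (V i).toSubmodule ≤ (radical ℂ 𝔤).toSubmodule :=
    fun i => hsum ▸ le_iSup (fun i => (V i).toSubmodule) i
  obtain ⟨D, hDL, hDV⟩ := exists_linearMap_eq_smul hLevi hindep hle c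
  have hdec : ∀ x : 𝔤, ∃ s ∈ L, ∃ u ∈ radical ℂ 𝔤, s + u = x := fun x =>
    Submodule.mem_sup.1 (hLevi.sup_eq_top ▸ Submodule.mem_top)
  have ind : ∀ P : 𝔤 → Prop, (∀ x ∈ L, P x) → (∀ i, ∀ x ∈ (V i).toSubmodule, P x) →
      (∀ x y, P x → P y → P (x + y)) → ∀ x, P x := by
    intro P hL hV hadd x
    obtain ⟨s, hs, u, hu, rfl⟩ := hdec x
    refine hadd _ _ (hL s hs) ?_
    rw [← LieSubmodule.mem_toSubmodule, ← hsum] at hu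
    exact Submodule.iSup_induction _ (motive := P) hu hV (hL 0 L.zero_mem) hadd
  have hDLV : ∀ a ∈ L, ∀ i, ∀ b ∈ (V i).toSubmodule, D ⁅a, b⁆ = c i • ⁅a, b⁆ :=
    fun a ha i b hb => hDV i _ ((V i).lie_mem (x := ⟨a, ha⟩) hb)
  have hD : ∀ a b : 𝔤, D ⁅a, b⁆ = ⁅a, D b⁆ - ⁅b, D a⁆ := by
    refine ind _ (fun a ha => ?_) (fun i a ha => ?_) (fun a a' h h' b => ?_)
    · refine ind _ (fun b hb => ?_) (fun j b hb => ?_) (fun b b' h h' => ?_)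
      · rw [hDL _ (L.lie_mem ha hb), hDL a ha, hDL b hb, lie_zero, lie_zero, sub_zero]
      · rw [hDLV a ha j b hb, hDV j b hb, hDL a ha, lie_smul, lie_zero, sub_zero]
      · rw [lie_add, map_add, h, h', map_add, lie_add, add_lie]
        abel
    · refine ind _ (fun b hb => ?_) (fun j b hb => ?_) (fun b b' h h' => ?_)
      · rw [← lie_skew, map_neg, hDLV b hb i a ha, hDL b hb, hDV i a ha, lie_smul, lie_zero,
          zero_sub]
      · rw [hDV i a ha, hDV j b hb, lie_smul, lie_smul, ← lie_skew b a, smul_neg, sub_neg_eq_add,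
          ← add_smul, add_comm (c j)]
        rcases hc i j with h | ⟨l, hl, hcl⟩
        · rw [lie_eq_zero_of_bracket_eq_bot h ha hb, map_zero, smul_zero]
        · rw [hDV l _ (hl ▸ lie_mem_bracket ha hb), hcl]
      · rw [lie_add, map_add, h, h', map_add, lie_add, add_lie]
        abel
    · rw [add_lie, map_add, h, h', map_add, lie_add, add_lie]
      abel
  obtain ⟨x, hx⟩ := hsymp.derivation_inner ⟨D, hD⟩
  replace hx : ∀ y, D y = ⁅x, y⁆ := hx
  obtain ⟨s, hs, u, hu, rfl⟩ := hdec x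
  -- As $D$ kills $L$, for $y\in L$ one has $[s,y]=-[u,y]\in L\cap\mathfrak h=0$, so $s$ is central
  -- in $L\cong\mathfrak{sl}_2$.
  have hs0 : s = 0 := by
    obtain ⟨t, ht⟩ : ∃ t, e t = ⟨s, hs⟩ := ⟨e.symm ⟨s, hs⟩, e.apply_symm_apply _⟩
    have ht0 : t = 0 := by
      refine sl2_eq_zero_of_lie_eq_zero fun y => e.injective ?_
      change e ⁅t, y⁆ = e 0
      rw [LieEquiv.map_lie, ht, map_zero]
      refine Subtype.ext ?_
      change ⁅s, (e y : 𝔤)⁆ = 0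
      have h := hx (e y : 𝔤)
      rw [hDL _ (e y).2, add_lie] at h
      refine Submodule.disjoint_def.1 hLevi.disjoint _ (L.lie_mem hs (e y).2) ?_
      rw [eq_neg_of_add_eq_zero_left h.symm]
      exact neg_mem (lie_mem_left ℂ 𝔤 (radical ℂ 𝔤) _ _ hu)
    rw [ht0, map_zero] at ht
    exact (congrArg Subtype.val ht).symm
  subst hs0
  by_contra hci
  obtain ⟨v, hv, hv0⟩ := Submodule.exists_mem_ne_zero_of_ne_bot (hne i)
  -- If $c_i\ne0$, then $[u,v]=c_iv$ puts the line of $v$ inside its own bracket with $\mathfrak h$.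
  have hspan : Submodule.span ℂ {v} = ⊥ := by
    refine eq_bot_of_le_bracket_radical (lie_top_radical_eq hsymp.perfect hLevi) ?_
    rw [Submodule.span_singleton_le_iff_mem]
    have h := hx v
    rw [hDV i v hv, zero_add] at h
    have h' : v = (c i)⁻¹ • ⁅u, v⁆ := by rw [← h, inv_smul_smul₀ hci]
    rw [h']
    refine Submodule.smul_mem _ _ (lie_mem_bracket hu ?_)
    rw [← h']
    exact Submodule.mem_span_singleton_self v
  exact hv0 (Submodule.span_singleton_eq_bot.1 hspan)

theorem isSympatheticTable (hsymp : IsSympathetic 𝔤)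
    (hLevi : IsCompl L.toSubmodule (radical ℂ 𝔤).toSubmodule)
    {w : Fin 4 → ℕ} {V : Fin 4 → LieSubmodule ℂ L 𝔤}
    (hV : ∀ i, IsIrrepOfHighestWeight e (V i) (w i))
    (hindep : iSupIndep fun i => (V i).toSubmodule)
    (hsum : ⨆ i, (V i).toSubmodule = (radical ℂ 𝔤).toSubmodule)
    (hbracket : ∀ i j, bracket (V i).toSubmodule (V j).toSubmodule = ⊥ ∨
      ∃ l, bracket (V i).toSubmodule (V j).toSubmodule = (V l).toSubmodule)
    (hcenter : centerOf (radical ℂ 𝔤) = (V 3).toSubmodule) :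
    IsSympatheticTable
      (fun i j l => bracket (V i).toSubmodule (V j).toSubmodule = (V l).toSubmodule) w 3 := by
  have hne : ∀ i, (V i).toSubmodule ≠ ⊥ := fun i => (hV i).ne_bot
  have hinj : Function.Injective fun i => (V i).toSubmodule := hindep.injective hne
  have hle : ∀ i, (V i).toSubmodule ≤ (radical ℂ 𝔤).toSubmodule :=
    fun i => hsum ▸ le_iSup (fun i => (V i).toSubmodule) i
  refine ⟨fun i j l h => ?_, fun i j l l' h h' => ?_, fun j l h => ?_, fun i hi => ?_,
    fun S hS => ?_, fun c hc => ?_, fun i j l m q h₁ h₂ => ?_, fun i j l h => ?_⟩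
  · rwa [bracket_comm]
  · exact hinj (h.symm.trans h')
  · refine hne l (h ▸ bracket_eq_bot fun u hu y hy => ?_)
    exact lie_eq_zero_of_mem_centerOf (hcenter ▸ hu) (hle j hy)
  · by_contra! hno
    refine hne i ((Submodule.eq_bot_iff _).2 fun x hx => ?_)
    refine Submodule.disjoint_def.1 (hindep.pairwiseDisjoint hi) x hx ?_
    change x ∈ (V 3).toSubmodule
    rw [← hcenter]
    refine mem_centerOf (hle i hx) fun y hy => ?_
    rw [← LieSubmodule.mem_toSubmodule, ← hsum] at hy
    refine Submodule.iSup_induction _ (motive := fun y => ⁅y, x⁆ = 0) hy (fun j y hy => ?_)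
      (zero_lie x) (fun y z h₁ h₂ => by rw [add_lie, h₁, h₂, add_zero])
    have hbot := (hbracket i j).resolve_right fun ⟨l, hl⟩ => hno j l hl
    rw [← lie_skew, lie_eq_zero_of_bracket_eq_bot hbot hx hy, neg_zero]
  · by_contra! hno
    -- If every summand in $S$ is a bracket with a factor in $S$, their sum $X$ satisfies
    -- $X\subseteq[\mathfrak h,X]$.
    have hX : ⨆ l ∈ S, (V l).toSubmodule = ⊥ := by
      refine eq_bot_of_le_bracket_radical (lie_top_radical_eq hsymp.perfect hLevi)
        (iSup₂_le fun l hl => ?_)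
      obtain ⟨i, j, hj, h⟩ := hno l hl
      rw [← h]
      exact bracket_mono (hle i) (le_iSup₂ (f := fun l (_ : l ∈ S) => (V l).toSubmodule) j hj)
    obtain ⟨l, hl⟩ := hS
    exact hne l (eq_bot_iff.2
      ((le_iSup₂ (f := fun l (_ : l ∈ S) => (V l).toSubmodule) l hl).trans hX.le))
  · funext i
    have := eq_zero_of_grading hsymp e hLevi hne hindep hsum (c := fun i => (c i : ℂ))
      (fun i j => (hbracket i j).imp_right fun ⟨l, hl⟩ => ⟨l, hl, by exact_mod_cast hc i j l hl⟩) i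
    exact_mod_cast this
  · by_contra! hno
    have hzero : ∀ i j, (∀ l' q', bracket (V j).toSubmodule (V m).toSubmodule = (V l').toSubmodule →
        bracket (V i).toSubmodule (V l').toSubmodule ≠ (V q').toSubmodule) →
        ∀ x ∈ V i, ∀ y ∈ V j, ∀ z ∈ V m, ⁅x, ⁅y, z⁆⁆ = 0 := by
      intro i j h x hx y hy z hz
      rcases hbracket j m with hjm | ⟨l', hl'⟩
      · rw [lie_eq_zero_of_bracket_eq_bot hjm hy hz, lie_zero]
      · have hbot := (hbracket i l').resolve_right fun ⟨q', hq'⟩ => h l' q' hl' hq'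
        exact lie_eq_zero_of_bracket_eq_bot hbot hx (hl' ▸ lie_mem_bracket hy hz)
    refine hne q (h₂ ▸ bracket_eq_bot fun a ha z hz => ?_)
    rw [← h₁] at ha
    induction ha using Submodule.span_induction with
    | zero => simp
    | add y y' _ _ h h' => rw [add_lie, h, h', add_zero]
    | smul t y _ h => rw [smul_lie, h, smul_zero]
    | mem a ha =>
      obtain ⟨x, hx, y, hy, rfl⟩ := ha
      rw [lie_lie, hzero i j hno.1 x hx y hy z hz, hzero j i hno.2 y hy x hx z hz, sub_zero]
  · obtain ⟨q, h₁, h₂⟩ := highestWeight_bracket (hV i) (hV j) (hV l) h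
    exact ⟨q, h₁, fun hij => h₂ (by rw [hij]) (by rw [hij])⟩

end Sympathetic

/-! ### Conclusion: evenness and residues modulo $4$. -/

theorem mainTheorem11 {𝔤 : Type*} [LieRing 𝔤] [LieAlgebra ℂ 𝔤] [FiniteDimensional ℂ 𝔤]
    (hsymp : Sympathetic.IsSympathetic 𝔤)
    -- the Levi decomposition `𝔤 = 𝔰𝔩₂(ℂ) ⋉ 𝔥` with `𝔥 = Rad(𝔤)`
    (L : LieSubalgebra ℂ 𝔤) (e : Sympathetic.SL2 ≃ₗ⁅ℂ⁆ L)
    (hLevi : IsCompl L.toSubmodule (LieAlgebra.radical ℂ 𝔤).toSubmodule)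
    -- the decomposition `𝔥 = V_n ⊕ V_m ⊕ V_p ⊕ V_k` into simple modules
    (n m p k : ℕ) (V : Fin 4 → LieSubmodule ℂ L 𝔤)
    (hV : ∀ i, Sympathetic.IsIrrepOfHighestWeight e (V i) (![n, m, p, k] i))
    (hindep : iSupIndep fun i => (V i).toSubmodule)
    (hsum : ⨆ i, (V i).toSubmodule = (LieAlgebra.radical ℂ 𝔤).toSubmodule)
    -- a non-zero bracket of two of the summands is again one of the summands
    (hbracket : ∀ i j, Sympathetic.bracket (V i).toSubmodule (V j).toSubmodule ≠ ⊥ →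
      ∃! l, Sympathetic.bracket (V i).toSubmodule (V j).toSubmodule = (V l).toSubmodule)
    -- `Z(𝔥) = V_k`
    (hcenter : Sympathetic.centerOf (LieAlgebra.radical ℂ 𝔤) = (V 3).toSubmodule) :
    (Even n ∧ Even m ∧ Even p ∧ Even k) ∧
    (Sympathetic.HasTable (fun i => (V i).toSubmodule) Sympathetic.table1 →
      p ≡ 2 [MOD 4] ∧ k ≡ 2 [MOD 4]) ∧
    (Sympathetic.HasTable (fun i => (V i).toSubmodule) Sympathetic.table2 → k ≡ 2 [MOD 4]) ∧
    (Sympathetic.HasTable (fun i => (V i).toSubmodule) Sympathetic.table3 → k ≡ 2 [MOD 4]) ∧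
    (Sympathetic.HasTable (fun i => (V i).toSubmodule) Sympathetic.table4 →
      p ≡ 2 [MOD 4] ∧ k ≡ 2 [MOD 4]) ∧
    (Sympathetic.HasTable (fun i => (V i).toSubmodule) Sympathetic.table5 → k ≡ 2 [MOD 4]) ∧
    (Sympathetic.HasTable (fun i => (V i).toSubmodule) Sympathetic.table6 →
      p ≡ 2 [MOD 4] ∧ k ≡ 2 [MOD 4]) := by
  have hT := Sympathetic.isSympatheticTable hsymp hLevi hV hindep hsum
    (fun i j => or_iff_not_imp_left.2 fun h => (hbracket i j h).exists) hcenter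
  have heven := hT.even
  -- Only the diagonal entries of a table matter: $2w_i-2q\equiv2$ modulo $4$ for $w_i$ even and $q$
  -- odd.
  have hsq : ∀ (T : Matrix (Fin 4) (Fin 4) (Option (Fin 4))) (i l : Fin 4),
      Sympathetic.HasTable (fun i => (V i).toSubmodule) T → T i i = some l →
      ![n, m, p, k] l ≡ 2 [MOD 4] := by
    intro T i l hHT hTi
    have h := hHT i i
    rw [hTi] at h
    obtain ⟨q, hq, hodd⟩ := hT.weight i i l h
    obtain ⟨r, rfl⟩ := hodd rfl
    obtain ⟨a, ha⟩ := heven i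
    rw [Nat.ModEq]
    lia
  refine ⟨⟨heven 0, heven 1, heven 2, heven 3⟩, fun h => ?_, fun h => ?_, fun h => ?_,
    fun h => ?_, fun h => ?_, fun h => ?_⟩
  · exact ⟨hsq _ 0 2 h rfl, hsq _ 1 3 h rfl⟩
  · exact hsq _ 0 3 h rfl
  · exact hsq _ 0 3 h rfl
  · exact ⟨hsq _ 0 2 h rfl, hsq _ 1 3 h rfl⟩
  · exact hsq _ 0 3 h rfl
  · exact ⟨hsq _ 0 2 h rfl, hsq _ 1 3 h rfl⟩
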